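/- **Notation.** Let $N$ be a lattice of rank $3$ and $N_{\mathbb R}=N\otimes\mathbb R$. A *cone* is a strongly convex rational polyhedral cone in $N_{\mathbb R}$; it is *nondegenerate* if it spans $N_{\mathbb R}$. For a cone $\tau$, $\mathrm{Gen}(\tau)\subset N$ is the set of primitive lattice points on the one-dimensional faces of $\tau$; $\tau$ is *simplicial* if it is generated by finitely many linearly independent vectors, and *smooth* if $\mathrm{Gen}(\tau)$ is part of a $\mathbb Z$-basis of $N$. A *subdivision* of a cone $\sigma$ is a finite fan with support $\sigma$; it corresponds to a proper birational toric morphism $X_\Sigma\to X_\sigma$. Let $\sigma$ be nondegenerate. A subdivision $\Sigma$ of $\sigma$ (or the morphism $X_\Sigma\to X_\sigma$) is a *moderate toric resolution* if every nondegenerate cone $\tau\in\Sigma$ is smooth and the affine hyperplane spanned by $\mathrm{Gen}(\tau)$ meets every one-dimensional face of $\sigma$. A subdivision $\Sigma$ of $\sigma$ (or the morphism $X_\Sigma\to X_\sigma$) is a *minimal terminal $\mathbb Q$-factorial model* of $X_\sigma$ if $X_\Sigma$ is $\mathbb Q$-factorial and terminal and its canonical divisor is nef over $X_\sigma$. In terms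 of $\Sigma$, this means: 1. every $\tau\in\Sigma$ is simplicial; 2. for every $\tau\in\Sigma$ there is a linear function $m$ on $N_{\mathbb R}$ with $m(u)=1$ for all $u\in\mathrm{Gen}(\tau)$ and $m(v)-1>0$ for every primitive $v\in\tau\cap N$ not in $\mathrm{Gen}(\tau)$; 3. there is a function $\varphi$ that is linear on each cone of $\Sigma$, equal to $1$ on $\mathrm{Gen}(\tau)$ for all $\tau\in\Sigma$, and concave on $\sigma$. **Theorem.** Let $\sigma$ be a nondegenerate cone in $N_{\mathbb R}$, so that $X_\sigma$ is a three-dimensional affine toric variety. If $\Sigma$ is a moderate toric resolution of $\sigma$, then $X_\Sigma\to X_\sigma$ is a minimal terminal $\mathbb Q$-factorial model of $X_\sigma$. Moreover, every cone of $\Sigma$ is contained in a cone over a bounded face of $P=\mathrm{Conv}(\sigma\cap N\setminus\{0\})$ (that is, $\Sigma$ subdivides the fan of the canonical model of $X_\sigma$), and every minimal generator of a cone of $\Sigma$ lies on a bounded face of $P$. -/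

import Mathlib

open scoped TensorProduct

namespace ToricFan

/-- The real vector space `N_ℝ = N ⊗ ℝ` of a lattice `N`. -/
abbrev NR (N : Type*) [AddCommGroup N] : Type _ := ℝ ⊗[ℤ] N

/-- The lattice point of `N_ℝ` given by an element of `N`. -/
noncomputable def lat {N : Type*} [AddCommGroup N] (n : N) : NR N := (1 : ℝ) ⊗ₜ[ℤ] n

/-- A cone in the sense of toric geometry: strongly convex, rational and polyhedral. -/
structure IsToricCone {N : Type*} [AddCommGroup N] (σ : PointedCone ℝ (NR N)) : Prop where
  rational_polyhedral : ∃ s : Finset N, σ = PointedCone.hull ℝ (lat '' (s : Set N))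
  strongly_convex : ∀ x ∈ σ, -x ∈ σ → x = 0

/-- The dimension of a cone: that of its linear span. -/
noncomputable def coneDim {N : Type*} [AddCommGroup N] (σ : PointedCone ℝ (NR N)) : ℕ :=
  Module.finrank ℝ (Submodule.span ℝ (σ : Set (NR N)))

/-- A cone is nondegenerate if it is full-dimensional. -/
def IsNondegenerate {N : Type*} [AddCommGroup N] (σ : PointedCone ℝ (NR N)) : Prop :=
  Submodule.span ℝ (σ : Set (NR N)) = ⊤

/-- `n ∈ N` is primitive if `ε n ∉ N` for all `0 < ε < 1`. -/
def IsPrimitive {N : Type*} [AddCommGroup N] (n : N) : Prop :=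
  ∀ ε : ℝ, 0 < ε → ε < 1 → ∀ m : N, lat m ≠ ε • lat n

/-- The set `Gen(σ)` of minimal generators of `σ`: the primitive lattice points on the
one-dimensional faces of `σ`. -/
def gen {N : Type*} [AddCommGroup N] (σ : PointedCone ℝ (NR N)) : Set N :=
  {n | IsPrimitive n ∧ (PointedCone.hull ℝ {lat n}).IsFaceOf σ}

/-- A cone is smooth if its minimal generators are part of a `ℤ`-basis of `N`. -/
def IsSmooth {N : Type*} [AddCommGroup N] (σ : PointedCone ℝ (NR N)) : Prop :=
  ∃ b : Module.Basis (Fin (Module.finrank ℤ N)) ℤ N, gen σ ⊆ Set.range b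

/-- A (finite) fan of cones in `N_ℝ`. -/
structure IsFan {N : Type*} [AddCommGroup N] (Δ : Set (PointedCone ℝ (NR N))) : Prop where
  finite : Δ.Finite
  isToricCone : ∀ τ ∈ Δ, IsToricCone τ
  face_mem : ∀ τ ∈ Δ, ∀ ρ : PointedCone ℝ (NR N), ρ.IsFaceOf τ → ρ ∈ Δ
  inter_face : ∀ τ₁ ∈ Δ, ∀ τ₂ ∈ Δ, (τ₁ ⊓ τ₂).IsFaceOf τ₁ ∧ (τ₁ ⊓ τ₂).IsFaceOf τ₂

/-- `Δ` is a subdivision of the cone `σ`: a fan with support `σ`. Equivalently, the toric morphism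
`X_Δ → X_σ` is proper and birational. -/
structure IsSubdivision {N : Type*} [AddCommGroup N] (Δ : Set (PointedCone ℝ (NR N)))
    (σ : PointedCone ℝ (NR N)) : Prop where
  isFan : IsFan Δ
  support_eq : (⋃ τ ∈ Δ, (τ : Set (NR N))) = (σ : Set (NR N))

/-- `Δ` is a moderate toric resolution of `σ`: a subdivision each of whose nondegenerate cones `τ`
is smooth, such that the affine hyperplane spanned by `Gen(τ)` meets every one-dimensional face
of `σ`. -/
structure IsModerateResolution {N : Type*} [AddCommGroup N] (Δ : Set (PointedCone ℝ (NR N)))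
    (σ : PointedCone ℝ (NR N)) : Prop where
  isSubdivision : IsSubdivision Δ σ
  smooth : ∀ τ ∈ Δ, IsNondegenerate τ → IsSmooth τ
  meets : ∀ τ ∈ Δ, IsNondegenerate τ →
    ∀ ρ : PointedCone ℝ (NR N), ρ.IsFaceOf σ → coneDim ρ = 1 →
      ((affineSpan ℝ (lat '' gen τ) : Set (NR N)) ∩ (ρ : Set (NR N))).Nonempty

/-- The affine toric variety of the cone `τ` has terminal singularities. There is a linear function
`m` taking the value `1` on the minimal generators (the canonical divisor is `ℚ`-Cartier), and
every exceptional torus invariant divisor over it, that is, every primitive `v ∈ τ` that is not a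
minimal generator, has positive discrepancy `m v - 1`. -/
def IsTerminal {N : Type*} [AddCommGroup N] (τ : PointedCone ℝ (NR N)) : Prop :=
  ∃ m : Module.Dual ℝ (NR N), (∀ u ∈ gen τ, m (lat u) = 1) ∧
    ∀ v : N, IsPrimitive v → lat v ∈ τ → v ∉ gen τ → 0 < m (lat v) - 1

/-- `φ` is the support function of the canonical divisor `K = -∑ D_ρ` on the fan `Δ`: linear on
each cone and equal to `1` on all minimal generators. -/
structure IsCanonicalSupportFunction {N : Type*} [AddCommGroup N]
    (Δ : Set (PointedCone ℝ (NR N))) (φ : NR N → ℝ) : Prop where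
  linear_on : ∀ τ ∈ Δ, ∃ m : Module.Dual ℝ (NR N), ∀ x ∈ τ, φ x = m x
  gen_eq_one : ∀ τ ∈ Δ, ∀ u ∈ gen τ, φ (lat u) = 1

/-- The canonical divisor of `X_Δ` is nef over `X_σ`: its support function is concave on the
full-dimensional cone `σ` (that is, `φ (x + y) ≥ φ x + φ y`). -/
def IsCanonicalNef {N : Type*} [AddCommGroup N] (Δ : Set (PointedCone ℝ (NR N)))
    (σ : PointedCone ℝ (NR N)) : Prop :=
  ∃ φ : NR N → ℝ, IsCanonicalSupportFunction Δ φ ∧ ConcaveOn ℝ (σ : Set (NR N)) φ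

/-- `X_Δ → X_σ` is a minimal terminal `ℚ`-factorial model: proper birational, `X_Δ` is
`ℚ`-factorial (`Δ` is simplicial) and terminal, and its canonical divisor is relatively nef. -/
structure IsMinimalTerminalQFactorialModel {N : Type*} [AddCommGroup N]
    (Δ : Set (PointedCone ℝ (NR N))) (σ : PointedCone ℝ (NR N)) : Prop where
  isSubdivision : IsSubdivision Δ σ
  simplicial : ∀ τ ∈ Δ, τ.IsSimplicial
  terminal : ∀ τ ∈ Δ, IsTerminal τ
  canonical_nef : IsCanonicalNef Δ σ

/-- The convex hull of the nonzero lattice points of `σ`. -/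
def latticeHull {N : Type*} [AddCommGroup N] (σ : PointedCone ℝ (NR N)) : Set (NR N) :=
  convexHull ℝ {x | ∃ n : N, n ≠ 0 ∧ lat n ∈ σ ∧ x = lat n}

/-- `F` is a bounded face of the convex set `P` in `N_ℝ`. Boundedness is tested on linear
functions. -/
structure IsBoundedFace {N : Type*} [AddCommGroup N] (P F : Set (NR N)) : Prop where
  extreme : IsExtreme ℝ P F
  convex : Convex ℝ F
  bounded : ∀ f : Module.Dual ℝ (NR N), ∃ C : ℝ, ∀ x ∈ F, |f x| ≤ C

/-- The fan of the canonical model of `X_σ`: the cones over the bounded faces of the convex hull of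
the nonzero lattice points of `σ` (the empty face gives the cone `0`). -/
def canonicalModel {N : Type*} [AddCommGroup N] (σ : PointedCone ℝ (NR N)) :
    Set (PointedCone ℝ (NR N)) :=
  {κ | ∃ F : Set (NR N), IsBoundedFace (latticeHull σ) F ∧ κ = PointedCone.hull ℝ F}

/-- `Δ` refines the fan of the canonical model of `X_σ`, and its minimal generators belong to the
bounded faces of the convex hull of the nonzero lattice points of `σ`. -/
structure SubdividesCanonicalModel {N : Type*} [AddCommGroup N]
    (Δ : Set (PointedCone ℝ (NR N))) (σ : PointedCone ℝ (NR N)) : Prop where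
  refines : ∀ τ ∈ Δ, ∃ κ ∈ canonicalModel σ, τ ≤ κ
  gen_mem : ∀ τ ∈ Δ, ∀ u ∈ gen τ, ∃ F, IsBoundedFace (latticeHull σ) F ∧ lat u ∈ F

end ToricFan

/-! For a nondegenerate `τ ∈ Δ`, smoothness makes `gen τ` a lattice basis, and the coordinate sum
`m_τ` is an integral linear function equal to `1` on `gen τ`, hence on its affine span. That affine
span meets every ray of `σ`, so `m_τ` is positive on the rays and therefore on `σ` minus the origin.
Being integral, it is at least `1` on every nonzero lattice point of `σ`
(`IsModerateResolution.exists_basis`).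

Everything follows from this bound. A lattice point of `τ` with `m_τ = 1` has nonnegative integer
coordinates of sum `1`, so it is a generator: this is terminality. The minimum of all the `m_τ` is
concave and agrees with `m_τ` on `τ`: this is nefness. The points of the lattice hull with `m_τ = 1`
form a bounded face containing `gen τ`.

Lower-dimensional cones reduce to this case, because each is a face of a nondegenerate cone of `Δ`
(`exists_isFaceOf_nondegenerate`). -/

namespace PointedCone

/-! ### Faces and generators of cones; avoiding finitely many subspaces. -/

variable {E : Type*} [AddCommGroup E] [Module ℝ E]

lemma mem_hull_singleton {v x : E} : x ∈ hull ℝ {v} ↔ ∃ c : ℝ, 0 ≤ c ∧ c • v = x := by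
  rw [hull, Submodule.mem_span_singleton]
  constructor
  · rintro ⟨c, rfl⟩
    exact ⟨c, c.2, rfl⟩
  · rintro ⟨c, hc, rfl⟩
    exact ⟨⟨c, hc⟩, rfl⟩

lemma hull_singleton_smul {v : E} {c : ℝ} (hc : 0 < c) : hull ℝ {c • v} = hull ℝ {v} := by
  ext x
  simp only [mem_hull_singleton]
  constructor
  · rintro ⟨a, ha, rfl⟩
    exact ⟨a * c, by positivity, mul_smul _ _ _⟩
  · rintro ⟨a, ha, rfl⟩
    exact ⟨a / c, by positivity, by rw [smul_smul, div_mul_cancel₀ _ hc.ne']⟩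

/-- If `t • x + y` is on the ray, the `D`-parts of `x` and `y` combine to a multiple of `v`. A
positive multiple would put `v` in `D`; otherwise the `D`-part of `x` has its negative in `C`, and
strong convexity kills it. -/
lemma hull_singleton_isFaceOf {C D : PointedCone ℝ E} {v : E} (hC : C = hull ℝ {v} ⊔ D)
    (hpt : ∀ x ∈ C, -x ∈ C → x = 0) (hv : v ∉ D) : (hull ℝ {v}).IsFaceOf C := by
  have hvC : hull ℝ {v} ≤ C := hC ▸ le_sup_left
  have hDC : D ≤ C := hC ▸ le_sup_right
  have hvm : v ∈ C := hvC (subset_hull rfl)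
  refine ⟨hvC, ?_⟩
  intro x y t hx hy ht hxy
  rw [hC, Submodule.mem_sup] at hx hy
  obtain ⟨_, h, p, hp, rfl⟩ := hx
  obtain ⟨a, ha, rfl⟩ := mem_hull_singleton.1 h
  obtain ⟨_, h, q, hq, rfl⟩ := hy
  obtain ⟨b, hb, rfl⟩ := mem_hull_singleton.1 h
  obtain ⟨c, hc, hxy⟩ := mem_hull_singleton.1 hxy
  have htp : t • p ∈ D := D.smul_mem ht.le hp
  have key : t • p + q = (c - t * a - b) • v := by
    rw [sub_smul, sub_smul, hxy, mul_smul, smul_add]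
    abel
  rcases lt_or_ge 0 (c - t * a - b) with hd | hd
  · refine absurd ?_ hv
    have := D.smul_mem (inv_nonneg.2 hd.le) (D.add_mem htp hq)
    rwa [key, smul_smul, inv_mul_cancel₀ hd.ne', one_smul] at this
  · have h0 : t • p = 0 := by
      refine hpt _ (hDC htp) ?_
      have h1 : -(t • p) = q + (-(c - t * a - b)) • v := by
        rw [neg_smul, ← key]
        abel
      rw [h1]
      exact C.add_mem (hDC hq) (C.smul_mem (by linarith) hvm)
    have hp0 : p = 0 := (smul_eq_zero.1 h0).resolve_left ht.ne'
    rw [hp0, add_zero]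
    exact mem_hull_singleton.2 ⟨a, ha, rfl⟩

/-- Discard redundant generators until none lies in the hull of the others; each survivor then spans
a face. -/
lemma exists_extremal_generators (C : PointedCone ℝ E) (hpt : ∀ x ∈ C, -x ∈ C → x = 0)
    (s : Finset E) (hs : C = hull ℝ (s : Set E)) :
    ∃ t ⊆ s, C = hull ℝ (t : Set E) ∧ ∀ v ∈ t, v ≠ 0 ∧ (hull ℝ {v}).IsFaceOf C := by
  classical
  induction s using Finset.strongInduction with
  | H s ih =>
    by_cases h : ∃ v ∈ s, v ∈ hull ℝ ((s.erase v : Finset E) : Set E)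
    · obtain ⟨v, hvs, hv⟩ := h
      obtain ⟨t, ht, h⟩ := ih (s.erase v) (Finset.erase_ssubset hvs) (by
        rw [hs]
        refine le_antisymm (Submodule.span_le.2 fun x hx ↦ ?_)
          (Submodule.span_mono (Finset.coe_subset.2 (Finset.erase_subset _ _)))
        by_cases hxv : x = v
        · exact hxv ▸ hv
        · exact subset_hull (Finset.mem_coe.2 (Finset.mem_erase.2 ⟨hxv, hx⟩)))
      exact ⟨t, ht.trans (Finset.erase_subset _ _), h⟩
    · push Not at h
      refine ⟨s, subset_rfl, hs, fun v hv ↦ ⟨?_, ?_⟩⟩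
      · rintro rfl
        exact h _ hv (zero_mem _)
      · refine hull_singleton_isFaceOf (D := hull ℝ ((s.erase v : Finset E) : Set E)) ?_ hpt (h v hv)
        rw [hs, ← Submodule.span_union, ← Finset.coe_singleton, ← Finset.coe_union,
          ← Finset.insert_eq, Finset.insert_erase hv]

lemma mem_hull_range_basis {ι : Type*} [Fintype ι] (B : Module.Basis ι ℝ E) {x : E} :
    x ∈ hull ℝ (Set.range B) ↔ ∀ i, 0 ≤ B.repr x i := by
  constructor
  · intro hx i
    induction hx using Submodule.span_induction with
    | mem x hx =>
      classical
      obtain ⟨j, rfl⟩ := hx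
      rw [B.repr_self, Finsupp.single_apply]
      split_ifs <;> norm_num
    | zero => simp
    | add x y _ _ hx hy => simpa using add_nonneg hx hy
    | smul c x _ hx =>
      have : c • x = (c : ℝ) • x := rfl
      rw [this, map_smul, Finsupp.smul_apply, smul_eq_mul]
      exact mul_nonneg c.2 hx
  · intro h
    rw [← B.sum_repr x]
    exact Submodule.sum_mem _ fun i _ ↦ smul_mem _ (h i) (subset_hull ⟨i, rfl⟩)

lemma IsFaceOf.eq_hull_of_basis {ι : Type*} [Fintype ι] (B : Module.Basis ι ℝ E)
    {F : PointedCone ℝ E} (hF : F.IsFaceOf (hull ℝ (Set.range B))) :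
    F = hull ℝ (Set.range B ∩ F) := by
  refine le_antisymm (fun x hx ↦ ?_) (Submodule.span_le.2 Set.inter_subset_right)
  have hc := (mem_hull_range_basis B).1 (hF.le hx)
  have hs := B.sum_repr x
  rw [← hs]
  refine Submodule.sum_mem _ fun i _ ↦ ?_
  rcases (hc i).eq_or_lt with h | h
  · rw [← h, zero_smul]
    exact zero_mem _
  · refine smul_mem _ h.le (subset_hull ⟨⟨i, rfl⟩, ?_⟩)
    exact hF.mem_of_sum_smul_mem (fun i ↦ subset_hull ⟨i, rfl⟩) hc (by rwa [hs]) i h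

lemma IsFaceOf.isSimplicial_of_basis {ι : Type*} [Fintype ι] (B : Module.Basis ι ℝ E)
    {F : PointedCone ℝ E} (hF : F.IsFaceOf (hull ℝ (Set.range B))) : F.IsSimplicial :=
  ⟨Set.range B ∩ F, (Set.finite_range B).subset Set.inter_subset_left,
    LinearIndepOn.mono B.linearIndependent.linearIndepOn_id Set.inter_subset_left,
    (hF.eq_hull_of_basis B).symm⟩

/-- A line meets a subspace not containing its direction in at most one point. -/
lemma line_inter_subsingleton {V : Submodule ℝ E} {w : E} (hw : w ∉ V) (x : E) :
    {t : ℝ | x + t • w ∈ V}.Subsingleton := by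
  intro s hs t ht
  by_contra hne
  have h1 : (s - t) • w ∈ V := by
    have := V.sub_mem hs ht
    rwa [add_sub_add_left_eq_sub, ← sub_smul] at this
  exact hw ((V.smul_mem_iff (sub_ne_zero.2 hne)).1 h1)

/-- A cone is not covered by finitely many subspaces none of which contains it. -/
lemma exists_mem_forall_notMem (C : PointedCone ℝ E) (𝒱 : Set (Submodule ℝ E)) (hfin : 𝒱.Finite)
    (h𝒱 : ∀ V ∈ 𝒱, ¬ (C : Set E) ⊆ V) : ∃ w ∈ C, ∀ V ∈ 𝒱, w ∉ V := by
  induction 𝒱, hfin using Set.Finite.induction_on with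
  | empty => exact ⟨0, zero_mem _, by simp⟩
  | @insert V 𝒱 _ hfin ih =>
    obtain ⟨w, hwC, hw⟩ := ih fun V hV ↦ h𝒱 V (Set.mem_insert_of_mem _ hV)
    obtain ⟨s, hsC, hsV⟩ := Set.not_subset.1 (h𝒱 V (Set.mem_insert _ _))
    -- Perturb `w` along `s ∉ V`: each subspace excludes at most one `t`, since if `s ∈ W` the point
    -- `w + t • s` never enters `W`.
    have hbad : ({t : ℝ | w + t • s ∈ V} ∪
        ⋃ W ∈ 𝒱, {t : ℝ | t ≠ 0 ∧ w + t • s ∈ W}).Finite := by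
      refine (line_inter_subsingleton hsV w).finite.union (hfin.biUnion fun W hW ↦ ?_)
      by_cases hs : s ∈ W
      · refine Set.Finite.subset Set.finite_empty fun t ht ↦ hw W hW ?_
        have := W.sub_mem ht.2 (W.smul_mem t hs)
        rwa [add_sub_cancel_right] at this
      · exact (line_inter_subsingleton hs w).finite.subset fun t ht ↦ ht.2
    obtain ⟨t, ht0, ht⟩ := (Set.Ioi_infinite (0 : ℝ)).exists_notMem_finite hbad
    simp only [Set.mem_union, Set.mem_iUnion, Set.mem_ofPred_eq, not_or, not_exists] at ht
    have ht0 : (0 : ℝ) < t := ht0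
    refine ⟨w + t • s, C.add_mem hwC (C.smul_mem ht0.le hsC), ?_⟩
    rintro W (rfl | hW)
    · exact ht.1
    · exact fun h ↦ ht.2 W hW ⟨ht0.ne', h⟩

end PointedCone

namespace ToricFan

open PointedCone

/-! ### Lattice points, primitive generators and coordinate sums. -/

section Lattice

variable {N : Type*} [AddCommGroup N]

lemma lat_zero : lat (0 : N) = 0 := TensorProduct.tmul_zero _ _

lemma repr_lat {ι : Type*} (b : Module.Basis ι ℤ N) (n : N) (i : ι) :
    (b.baseChange ℝ).repr (lat n) i = (b.repr n i : ℝ) := by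
  rw [lat, Module.Basis.baseChange_repr_tmul]
  simp

lemma baseChange_eq_lat {ι : Type*} (b : Module.Basis ι ℤ N) (i : ι) :
    b.baseChange ℝ i = lat (b i) := Module.Basis.baseChange_apply _ _ _

lemma lat_image_range {ι : Type*} (b : Module.Basis ι ℤ N) :
    lat '' Set.range b = Set.range (b.baseChange ℝ) := by
  rw [← Set.range_comp]
  congr 1
  funext i
  exact (baseChange_eq_lat b i).symm

lemma lat_injective [Module.Free ℤ N] : Function.Injective (lat (N := N)) := by
  intro m n h
  let b := Module.Free.chooseBasis ℤ N
  refine b.repr.injective (Finsupp.ext fun i ↦ ?_)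
  have := congrArg (fun x ↦ (b.baseChange ℝ).repr x i) h
  simpa only [repr_lat, Int.cast_inj] using this

lemma lat_ne_zero [Module.Free ℤ N] {n : N} (hn : n ≠ 0) : lat n ≠ 0 := fun h ↦
  hn (lat_injective (h.trans lat_zero.symm))

lemma IsPrimitive.ne_zero {n : N} (hn : IsPrimitive n) : n ≠ 0 := by
  rintro rfl
  exact hn (1 / 2) (by norm_num) (by norm_num) 0 (by simp [lat_zero])

/-- Descent on the absolute value of a fixed nonzero coordinate: if `n` is not primitive, some
lattice point `ε • n` has a smaller one. -/
lemma exists_primitive [Module.Free ℤ N] {n : N} (hn : n ≠ 0) :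
    ∃ m : N, IsPrimitive m ∧ ∃ c : ℝ, 0 < c ∧ lat n = c • lat m := by
  let b := Module.Free.chooseBasis ℤ N
  obtain ⟨i, hi⟩ : ∃ i, b.repr n i ≠ 0 := by
    by_contra! h
    exact hn (b.repr.map_eq_zero_iff.1 (Finsupp.ext h))
  clear hn
  induction hk : (b.repr n i).natAbs using Nat.strong_induction_on generalizing n with
  | _ k ih =>
    by_cases hp : IsPrimitive n
    · exact ⟨n, hp, 1, one_pos, (one_smul _ _).symm⟩
    · simp only [IsPrimitive] at hp
      push Not at hp
      obtain ⟨ε, h0, h1, m, hm⟩ := hp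
      have hc : (b.repr m i : ℝ) = ε * b.repr n i := by
        rw [← repr_lat, hm, map_smul, Finsupp.smul_apply, repr_lat, smul_eq_mul]
      have hi' : (b.repr n i : ℝ) ≠ 0 := by exact_mod_cast hi
      have hmi : b.repr m i ≠ 0 := by
        have : (b.repr m i : ℝ) ≠ 0 := hc ▸ mul_ne_zero h0.ne' hi'
        exact_mod_cast this
      have hlt : (b.repr m i).natAbs < k := by
        rw [← hk]
        zify
        have : |(b.repr m i : ℝ)| < |(b.repr n i : ℝ)| := by
          rw [hc, abs_mul, abs_of_pos h0]
          exact mul_lt_of_lt_one_left (abs_pos.2 hi') h1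
        exact_mod_cast this
      obtain ⟨p, hp, c, hc0, hcp⟩ := ih _ hlt hmi rfl
      refine ⟨p, hp, ε⁻¹ * c, by positivity, ?_⟩
      rw [mul_smul, ← hcp, hm, smul_smul, inv_mul_cancel₀ h0.ne', one_smul]

lemma gen_subset (τ : PointedCone ℝ (NR N)) : lat '' gen τ ⊆ τ := by
  rintro _ ⟨n, hn, rfl⟩
  exact hn.2.le (subset_hull rfl)

lemma IsToricCone.eq_hull_gen [Module.Free ℤ N] {τ : PointedCone ℝ (NR N)} (hτ : IsToricCone τ) :
    τ = hull ℝ (lat '' gen τ) := by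
  classical
  refine le_antisymm ?_ (Submodule.span_le.2 (gen_subset τ))
  obtain ⟨s, hs⟩ := hτ.rational_polyhedral
  obtain ⟨t, hts, htC, ht⟩ := exists_extremal_generators τ hτ.strongly_convex (s.image lat)
    (by rw [hs, Finset.coe_image])
  conv_lhs => rw [htC]
  refine Submodule.span_le.2 fun v hv ↦ ?_
  obtain ⟨n, -, rfl⟩ := Finset.mem_image.1 (hts hv)
  obtain ⟨h0, hface⟩ := ht _ hv
  obtain ⟨m, hm, c, hc, hcm⟩ := exists_primitive (n := n) (by rintro rfl; exact h0 lat_zero)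
  rw [hcm, hull_singleton_smul hc] at hface
  rw [SetLike.mem_coe, hcm]
  exact PointedCone.smul_mem _ hc.le (subset_hull ⟨m, ⟨hm, hface⟩, rfl⟩)

/-- The generators of a nondegenerate smooth cone form a basis of the lattice. -/
lemma IsSmooth.exists_basis [Module.Free ℤ N] {τ : PointedCone ℝ (NR N)} (hτ : IsToricCone τ)
    (hτ' : IsNondegenerate τ) (hs : IsSmooth τ) :
    ∃ b : Module.Basis (Fin (Module.finrank ℤ N)) ℤ N, gen τ = Set.range b := by
  obtain ⟨b, hb⟩ := hs
  refine ⟨b, hb.antisymm ?_⟩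
  rintro _ ⟨i, rfl⟩
  by_contra hi
  -- If `b i` were not a generator, the `i`-th coordinate would vanish on all of `τ`, which spans
  -- the whole space.
  have hle : Submodule.span ℝ (τ : Set (NR N)) ≤ LinearMap.ker ((b.baseChange ℝ).coord i) := by
    refine Submodule.span_le.2 fun x hx ↦ ?_
    rw [SetLike.mem_coe, hτ.eq_hull_gen] at hx
    refine Submodule.span_le.2 ?_ (hull_le_span ℝ _ hx)
    rintro _ ⟨n, hn, rfl⟩
    obtain ⟨j, rfl⟩ := hb hn
    have hij : j ≠ i := by rintro rfl; exact hi hn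
    rw [SetLike.mem_coe, LinearMap.mem_ker, Module.Basis.coord_apply, repr_lat, b.repr_self,
      Finsupp.single_eq_of_ne hij.symm, Int.cast_zero]
  rw [hτ'] at hle
  have := hle (Submodule.mem_top (x := b.baseChange ℝ i))
  rw [LinearMap.mem_ker, Module.Basis.coord_apply, Module.Basis.repr_self] at this
  simp at this

lemma gen_face_subset {F τ : PointedCone ℝ (NR N)} (hF : F.IsFaceOf τ) : gen F ⊆ gen τ :=
  fun _ hn ↦ ⟨hn.1, hn.2.trans hF⟩

lemma mem_gen_face {F τ : PointedCone ℝ (NR N)} (hF : F.IsFaceOf τ) {n : N} (hn : n ∈ gen τ)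
    (hnF : lat n ∈ F) : n ∈ gen F :=
  ⟨hn.1, (hn.2.isFaceOf_iff_le hF).2 (Submodule.span_le.2 (by simpa using hnF))⟩

lemma coneDim_hull_singleton {v : NR N} (hv : v ≠ 0) : coneDim (hull ℝ {v}) = 1 := by
  have : Submodule.span ℝ ((hull ℝ {v} : PointedCone ℝ (NR N)) : Set (NR N)) =
      Submodule.span ℝ {v} :=
    le_antisymm (Submodule.span_le.2 (hull_le_span ℝ _)) (Submodule.span_mono subset_hull)
  rw [coneDim, this, finrank_span_singleton hv]

/-- The sum of the coordinates with respect to a basis of the lattice. -/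
noncomputable def coordSum {ι : Type*} [Fintype ι] (b : Module.Basis ι ℤ N) :
    Module.Dual ℝ (NR N) := ∑ i, (b.baseChange ℝ).coord i

lemma coordSum_apply {ι : Type*} [Fintype ι] (b : Module.Basis ι ℤ N) (x : NR N) :
    coordSum b x = ∑ i, (b.baseChange ℝ).repr x i := by
  simp [coordSum, LinearMap.sum_apply]

lemma coordSum_lat {ι : Type*} [Fintype ι] (b : Module.Basis ι ℤ N) (n : N) :
    coordSum b (lat n) = ((∑ i, b.repr n i : ℤ) : ℝ) := by
  simp only [coordSum_apply, repr_lat, Int.cast_sum]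

lemma coordSum_basis {ι : Type*} [Fintype ι] (b : Module.Basis ι ℤ N) (i : ι) :
    coordSum b (lat (b i)) = 1 := by
  classical
  rw [coordSum_lat, b.repr_self]
  simp [Finsupp.single_apply]

/-- A lattice point with nonnegative coordinates of sum `1` is a basis vector. -/
lemma mem_range_of_coordSum_eq_one {ι : Type*} [Fintype ι] (b : Module.Basis ι ℤ N) {n : N}
    (hn : lat n ∈ hull ℝ (Set.range (b.baseChange ℝ))) (h1 : coordSum b (lat n) = 1) :
    n ∈ Set.range b := by
  classical
  have h0 : ∀ i, 0 ≤ b.repr n i := fun i ↦ by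
    have := (mem_hull_range_basis _).1 hn i
    rw [repr_lat] at this
    exact_mod_cast this
  rw [coordSum_lat] at h1
  have h1 : ∑ i, b.repr n i = 1 := by exact_mod_cast h1
  obtain ⟨i, -, hi⟩ : ∃ i ∈ Finset.univ, b.repr n i ≠ 0 :=
    Finset.exists_ne_zero_of_sum_ne_zero (by rw [h1]; exact one_ne_zero)
  have hi1 : 1 ≤ b.repr n i := by have := h0 i; omega
  rw [← Finset.add_sum_erase _ _ (Finset.mem_univ i)] at h1
  have hrest : 0 ≤ ∑ j ∈ Finset.univ.erase i, b.repr n j := Finset.sum_nonneg fun j _ ↦ h0 j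
  have hz : ∑ j ∈ Finset.univ.erase i, b.repr n j = 0 := by omega
  have hii : b.repr n i = 1 := by omega
  rw [Finset.sum_eq_zero_iff_of_nonneg fun j _ ↦ h0 j] at hz
  refine ⟨i, b.repr.injective ?_⟩
  rw [b.repr_self]
  ext j
  by_cases hj : j = i
  · rw [hj, hii, Finsupp.single_eq_same]
  · rw [Finsupp.single_eq_of_ne hj, hz j (Finset.mem_erase.2 ⟨hj, Finset.mem_univ j⟩)]

/-- A linear function that is positive on a finitely generated cone dominates, up to a constant,
all linear functions there. -/
lemma exists_abs_le_mul {E : Type*} [AddCommGroup E] [Module ℝ E] (s : Finset E)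
    (m : Module.Dual ℝ E) (hm : ∀ x ∈ s, x ≠ 0 → 0 < m x) (f : Module.Dual ℝ E) :
    ∃ K : ℝ, ∀ x ∈ hull ℝ (s : Set E), |f x| ≤ K * m x := by
  -- Each ratio bounds `|f|` by a multiple of `m` on its own generator; a zero generator contributes
  -- `0 / 0 = 0`.
  refine ⟨∑ x ∈ s, |f x| / |m x|, fun x hx ↦ ?_⟩
  induction hx using Submodule.span_induction with
  | mem x hx =>
    by_cases h0 : x = 0
    · simp [h0]
    · have hpos := hm x hx h0
      have : |f x| / |m x| ≤ ∑ x ∈ s, |f x| / |m x| :=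
        Finset.single_le_sum (f := fun x ↦ |f x| / |m x|) (fun _ _ ↦ by positivity) hx
      rw [abs_of_pos hpos, div_le_iff₀ hpos] at this
      exact this
  | zero => simp
  | add x y _ _ hx hy =>
    rw [map_add, map_add, mul_add]
    exact (abs_add_le _ _).trans (add_le_add hx hy)
  | smul c x _ hx =>
    have : c • x = (c : ℝ) • x := rfl
    rw [this, map_smul, map_smul, smul_eq_mul, smul_eq_mul, abs_mul, abs_of_nonneg c.2,
      mul_left_comm]
    exact mul_le_mul_of_nonneg_left hx c.2

/-- The face of the lattice hull on which a linear function attains its minimum `1`. -/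
lemma isBoundedFace_of_dual {σ : PointedCone ℝ (NR N)} {m : Module.Dual ℝ (NR N)}
    (hσ : IsToricCone σ) (hpos : ∀ x ∈ σ, x ≠ 0 → 0 < m x)
    (hone : ∀ n : N, n ≠ 0 → lat n ∈ σ → 1 ≤ m (lat n)) :
    IsBoundedFace (latticeHull σ) (latticeHull σ ∩ {x | m x = 1}) := by
  classical
  have hle : ∀ x ∈ latticeHull σ, 1 ≤ m x := fun x hx ↦ by
    refine convexHull_min (t := {x | 1 ≤ m x}) ?_ (convex_halfSpace_ge m.isLinear 1) hx
    rintro _ ⟨n, hn, hnσ, rfl⟩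
    exact hone n hn hnσ
  refine ⟨⟨Set.inter_subset_left, ?_⟩, ?_, fun f ↦ ?_⟩
  · rintro x hx y hy z ⟨-, hz⟩ ⟨a, b, ha, hb, hab, rfl⟩
    refine ⟨hx, ?_⟩
    have h1 := hle x hx
    have h2 := hle y hy
    simp only [Set.mem_ofPred_eq, map_add, map_smul, smul_eq_mul] at hz ⊢
    nlinarith
  · exact (convex_convexHull ℝ _).inter (convex_hyperplane m.isLinear 1)
  · obtain ⟨s, hs⟩ := hσ.rational_polyhedral
    rw [← Finset.coe_image] at hs
    obtain ⟨K, hK⟩ := exists_abs_le_mul (s.image lat) m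
      (fun x hx ↦ hpos x (hs ▸ subset_hull (Finset.mem_coe.2 hx))) f
    refine ⟨K, fun x hx ↦ ?_⟩
    have hxσ : x ∈ σ := by
      refine convexHull_min (t := (σ : Set (NR N))) ?_ (PointedCone.convex σ) hx.1
      rintro _ ⟨n, -, hnσ, rfl⟩
      exact hnσ
    have := hK x (hs ▸ hxσ)
    rwa [hx.2, mul_one] at this

lemma IsSubdivision.le {σ : PointedCone ℝ (NR N)} {Δ : Set (PointedCone ℝ (NR N))}
    (hΔ : IsSubdivision Δ σ) {τ : PointedCone ℝ (NR N)} (hτ : τ ∈ Δ) : τ ≤ σ := fun x hx ↦ by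
  rw [← SetLike.mem_coe, ← hΔ.support_eq]
  exact Set.mem_biUnion hτ hx

end Lattice

/-! ### Consequences of moderateness. -/

section ModerateResolution

variable {N : Type*} [AddCommGroup N] [Module.Free ℤ N]
  {σ : PointedCone ℝ (NR N)} {Δ : Set (PointedCone ℝ (NR N))}

/-- Each cone of a subdivision of a nondegenerate cone is a face of a nondegenerate cone of the
subdivision, if these are smooth. -/
lemma IsModerateResolution.exists_isFaceOf_nondegenerate (hΔ : IsModerateResolution Δ σ)
    (hσ : IsNondegenerate σ) {τ : PointedCone ℝ (NR N)} (hτ : τ ∈ Δ) :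
    ∃ τ' ∈ Δ, IsNondegenerate τ' ∧ τ.IsFaceOf τ' := by
  have hfan := hΔ.isSubdivision.isFan
  obtain ⟨s, hs⟩ := (hfan.isToricCone τ hτ).rational_polyhedral
  -- A relative interior point of `τ`: a face of `τ` containing `x` contains every summand, hence
  -- all of `τ`.
  set x : NR N := ∑ n ∈ s, lat n with hx
  have hsτ : ∀ n ∈ s, lat n ∈ τ := fun n hn ↦ hs ▸ subset_hull ⟨n, hn, rfl⟩
  have hxσ : x ∈ σ :=
    hΔ.isSubdivision.le hτ (Submodule.sum_mem _ hsτ)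
  let 𝒱 : Set (Submodule ℝ (NR N)) :=
    (fun κ : PointedCone ℝ (NR N) ↦ Submodule.span ℝ (κ : Set (NR N))) ''
      {κ ∈ Δ | ¬ IsNondegenerate κ}
  have h𝒱fin : 𝒱.Finite := (hfan.finite.subset (Set.sep_subset _ _)).image _
  -- A generic direction: `x + t • w` lies in a degenerate cone for only finitely many `t`.
  obtain ⟨w, hwσ, hw⟩ := exists_mem_forall_notMem σ 𝒱 h𝒱fin (by
    rintro _ ⟨κ, ⟨-, hκ⟩, rfl⟩ hle
    exact hκ (top_le_iff.1 (hσ.symm.trans_le (Submodule.span_le.2 hle))))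
  have hbad : (⋃ V ∈ 𝒱, {t : ℝ | x + t • w ∈ V}).Finite :=
    h𝒱fin.biUnion fun V hV ↦ (line_inter_subsingleton (hw V hV) x).finite
  have hcover : ∀ t : ℝ, 0 < t → t ∉ ⋃ V ∈ 𝒱, {t : ℝ | x + t • w ∈ V} →
      ∃ κ ∈ Δ, IsNondegenerate κ ∧ x + t • w ∈ κ := by
    intro t ht hnot
    have hmem : x + t • w ∈ (σ : Set (NR N)) := σ.add_mem hxσ (σ.smul_mem ht.le hwσ)
    rw [← hΔ.isSubdivision.support_eq] at hmem
    obtain ⟨κ, hκ, hxκ⟩ := Set.mem_iUnion₂.1 hmem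
    refine ⟨κ, hκ, by_contra fun hdeg ↦ hnot ?_, hxκ⟩
    exact Set.mem_biUnion ⟨κ, ⟨hκ, hdeg⟩, rfl⟩ (Submodule.subset_span hxκ)
  -- By finiteness of `Δ`, a single nondegenerate cone contains `x + t • w` for arbitrarily small `t
  -- > 0`; it then contains the limit `x`.
  obtain ⟨τ', hτ', hτ'n, hfreq⟩ : ∃ τ' ∈ Δ, IsNondegenerate τ' ∧
      ∀ ε : ℝ, 0 < ε → ∃ t, 0 < t ∧ t < ε ∧ x + t • w ∈ τ' := by
    by_contra! hcon
    choose! ε hε0 hε using hcon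
    obtain ⟨δ, hδ0, hδ⟩ : ∃ δ : ℝ, 0 < δ ∧ ∀ κ ∈ Δ, IsNondegenerate κ → δ ≤ ε κ := by
      obtain ⟨δ, hδ⟩ : ∃ δ : {t : ℝ // 0 < t},
          ∀ κ ∈ hfan.finite.toFinset, IsNondegenerate κ → (δ : ℝ) ≤ ε κ := by
        generalize hT : hfan.finite.toFinset = T
        have hTΔ : ∀ κ ∈ T, κ ∈ Δ := fun κ hκ ↦ hfan.finite.mem_toFinset.1 (hT ▸ hκ)
        clear hT
        classical
        induction T using Finset.induction_on with
        | empty => exact ⟨⟨1, one_pos⟩, by simp⟩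
        | insert κ T _ ih =>
          obtain ⟨δ, hδ⟩ := ih fun κ hκ ↦ hTΔ κ (Finset.mem_insert_of_mem hκ)
          by_cases hκ : IsNondegenerate κ
          · refine ⟨⟨min δ (ε κ), lt_min δ.2 (hε0 κ (hTΔ κ (Finset.mem_insert_self _ _)) hκ)⟩, ?_⟩
            intro κ' hκ' hn
            rcases Finset.mem_insert.1 hκ' with rfl | h
            · exact min_le_right _ _
            · exact (min_le_left _ _).trans (hδ κ' h hn)
          · refine ⟨δ, fun κ' hκ' hn ↦ ?_⟩
            rcases Finset.mem_insert.1 hκ' with rfl | h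
            · exact absurd hn hκ
            · exact hδ κ' h hn
      exact ⟨δ, δ.2, fun κ hκ ↦ hδ κ (hfan.finite.mem_toFinset.2 hκ)⟩
    obtain ⟨t, ht, htb⟩ := (Set.Ioo_infinite hδ0).exists_notMem_finite hbad
    obtain ⟨κ, hκ, hκn, hmem⟩ := hcover t ht.1 htb
    exact hε κ hκ hκn t ht.1 (ht.2.trans_le (hδ κ hκ hκn)) hmem
  have hτ't := hfan.isToricCone τ' hτ'
  obtain ⟨b, hb⟩ := (hΔ.smooth τ' hτ' hτ'n).exists_basis hτ't hτ'n
  have hxτ' : x ∈ τ' := by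
    have hmem : ∀ y, y ∈ τ' ↔ ∀ i, 0 ≤ (b.baseChange ℝ).repr y i := fun y ↦ by
      rw [← mem_hull_range_basis, ← lat_image_range, ← hb, ← hτ't.eq_hull_gen]
    rw [hmem]
    intro i
    by_contra! hneg
    set p := (b.baseChange ℝ).repr x i
    set q := (b.baseChange ℝ).repr w i with hq
    -- Below this bound `t * |q| < -p`, so the coordinate `p + t * q` would still be negative.
    obtain ⟨t, ht0, ht, htm⟩ := hfreq (-p / (|q| + 1)) (by have := neg_pos.2 hneg; positivity)
    have h := (hmem _).1 htm i
    rw [map_add, map_smul, Finsupp.add_apply, Finsupp.smul_apply, smul_eq_mul, ← hq] at h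
    rw [lt_div_iff₀ (by positivity)] at ht
    change 0 ≤ p + t * q at h
    nlinarith [le_abs_self q]
  have hface := hfan.inter_face τ hτ τ' hτ'
  have hle : τ ≤ τ ⊓ τ' := by
    conv_lhs => rw [hs]
    refine Submodule.span_le.2 ?_
    rintro _ ⟨n, hn, rfl⟩
    have hxm : x ∈ τ ⊓ τ' := ⟨Submodule.sum_mem _ hsτ, hxτ'⟩
    classical
    have hn : n ∈ s := hn
    rw [hx, ← Finset.add_sum_erase _ _ hn] at hxm
    exact hface.1.mem_of_add_mem_left (hsτ n hn)
      (Submodule.sum_mem _ fun k hk ↦ hsτ k (Finset.mem_of_mem_erase hk)) hxm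
  refine ⟨τ', hτ', hτ'n, ?_⟩
  have := hface.2
  rwa [le_antisymm inf_le_left hle] at this

/-- The linear function equal to `1` on the generators of a nondegenerate cone of a moderate
resolution is at least `1` on the nonzero lattice points of the resolved cone. -/
lemma IsModerateResolution.exists_basis (hΔ : IsModerateResolution Δ σ) (hσ : IsToricCone σ)
    {τ : PointedCone ℝ (NR N)} (hτ : τ ∈ Δ) (hτ' : IsNondegenerate τ) :
    ∃ b : Module.Basis (Fin (Module.finrank ℤ N)) ℤ N, gen τ = Set.range b ∧
      τ = hull ℝ (Set.range (b.baseChange ℝ)) ∧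
      (∀ x ∈ σ, x ≠ 0 → 0 < coordSum b x) ∧
      ∀ n : N, n ≠ 0 → lat n ∈ σ → 1 ≤ coordSum b (lat n) := by
  have hτt := hΔ.isSubdivision.isFan.isToricCone τ hτ
  obtain ⟨b, hb⟩ := (hΔ.smooth τ hτ hτ').exists_basis hτt hτ'
  have hgen : ∀ n ∈ gen σ, 0 < coordSum b (lat n) := by
    intro n hn
    obtain ⟨x, hxa, hxρ⟩ := hΔ.meets τ hτ hτ' _ hn.2
      (coneDim_hull_singleton (lat_ne_zero hn.1.ne_zero))
    obtain ⟨c, hc, rfl⟩ := mem_hull_singleton.1 hxρ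
    have h1 : coordSum b (c • lat n) = 1 := by
      refine affineSpan_induction (p := fun x ↦ coordSum b x = 1) hxa ?_ fun r u v w hu hv hw ↦ ?_
      · rintro _ ⟨k, hk, rfl⟩
        obtain ⟨i, rfl⟩ := hb ▸ hk
        exact coordSum_basis b i
      · simp [hu, hv, hw]
    rw [map_smul, smul_eq_mul] at h1
    exact pos_of_mul_pos_right (h1 ▸ one_pos) hc
  have hpos : ∀ x ∈ σ, x ≠ 0 → 0 < coordSum b x := by
    have : ∀ x ∈ σ, x = 0 ∨ 0 < coordSum b x := by
      intro x hx
      rw [hσ.eq_hull_gen] at hx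
      induction hx using Submodule.span_induction with
      | mem x hx =>
        obtain ⟨n, hn, rfl⟩ := hx
        exact Or.inr (hgen n hn)
      | zero => exact Or.inl rfl
      | add x y _ _ hx hy =>
        rcases hx with rfl | hx
        · rwa [zero_add]
        · rcases hy with rfl | hy
          · rw [add_zero]
            exact Or.inr hx
          · rw [map_add]
            exact Or.inr (add_pos hx hy)
      | smul c x _ hx =>
        have hc : c • x = (c : ℝ) • x := rfl
        rcases hx with rfl | hx
        · exact Or.inl (smul_zero _)
        · rcases c.2.eq_or_lt with h | h
          · rw [hc, ← h, zero_smul]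
            exact Or.inl rfl
          · rw [hc, map_smul, smul_eq_mul]
            exact Or.inr (mul_pos h hx)
    exact fun x hx h0 ↦ (this x hx).resolve_left h0
  refine ⟨b, hb, ?_, hpos, fun n hn hnσ ↦ ?_⟩
  · rw [← lat_image_range, ← hb, ← hτt.eq_hull_gen]
  -- On lattice points the coordinate sum is an integer, so positive means at least `1`.
  · have := hpos _ hnσ (lat_ne_zero hn)
    rw [coordSum_lat] at this ⊢
    exact_mod_cast Int.add_one_le_iff.2 (Int.cast_pos.1 this)

lemma IsModerateResolution.isSimplicial (hΔ : IsModerateResolution Δ σ) (hσ : IsToricCone σ)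
    (hσ' : IsNondegenerate σ) {τ : PointedCone ℝ (NR N)} (hτ : τ ∈ Δ) : τ.IsSimplicial := by
  obtain ⟨τ', hτ', hτ'n, hface⟩ := hΔ.exists_isFaceOf_nondegenerate hσ' hτ
  obtain ⟨b, -, hhull, -⟩ := hΔ.exists_basis hσ hτ' hτ'n
  rw [hhull] at hface
  exact hface.isSimplicial_of_basis _

lemma IsModerateResolution.isTerminal (hΔ : IsModerateResolution Δ σ) (hσ : IsToricCone σ)
    (hσ' : IsNondegenerate σ) {τ : PointedCone ℝ (NR N)} (hτ : τ ∈ Δ) : IsTerminal τ := by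
  obtain ⟨τ', hτ', hτ'n, hface⟩ := hΔ.exists_isFaceOf_nondegenerate hσ' hτ
  obtain ⟨b, hb, hhull, -, hone⟩ := hΔ.exists_basis hσ hτ' hτ'n
  refine ⟨coordSum b, fun u hu ↦ ?_, fun v hv hvτ hvg ↦ ?_⟩
  · obtain ⟨i, rfl⟩ := hb ▸ gen_face_subset hface hu
    exact coordSum_basis b i
  · refine sub_pos.2 (lt_of_le_of_ne
      (hone v hv.ne_zero (hΔ.isSubdivision.le hτ hvτ)) fun h ↦ hvg ?_)
    refine mem_gen_face hface ?_ hvτ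
    rw [hb]
    exact mem_range_of_coordSum_eq_one b (hhull ▸ hface.le hvτ) h.symm

lemma IsModerateResolution.isCanonicalNef (hΔ : IsModerateResolution Δ σ) (hσ : IsToricCone σ)
    (hσ' : IsNondegenerate σ) : IsCanonicalNef Δ σ := by
  classical
  have hfan := hΔ.isSubdivision.isFan
  have hdual : ∀ τ ∈ Δ, IsNondegenerate τ → ∃ m : Module.Dual ℝ (NR N),
      (∀ n ∈ gen τ, m (lat n) = 1) ∧ ∀ n : N, n ≠ 0 → lat n ∈ σ → 1 ≤ m (lat n) := by
    intro τ hτ hτ'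
    obtain ⟨b, hb, -, -, hone⟩ := hΔ.exists_basis hσ hτ hτ'
    refine ⟨coordSum b, fun n hn ↦ ?_, hone⟩
    obtain ⟨i, rfl⟩ := hb ▸ hn
    exact coordSum_basis b i
  choose! m hgen hone using hdual
  let T := hfan.finite.toFinset.filter fun τ ↦ IsNondegenerate τ
  have hT : ∀ τ, τ ∈ T ↔ τ ∈ Δ ∧ IsNondegenerate τ := fun τ ↦ by simp [T]
  have hne : T.Nonempty := by
    have h0 : (0 : NR N) ∈ (σ : Set (NR N)) := zero_mem σ
    rw [← hΔ.isSubdivision.support_eq] at h0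
    obtain ⟨κ, hκ, -⟩ := Set.mem_iUnion₂.1 h0
    obtain ⟨τ, hτ, hτn, -⟩ := hΔ.exists_isFaceOf_nondegenerate hσ' hκ
    exact ⟨τ, (hT τ).2 ⟨hτ, hτn⟩⟩
  let φ : NR N → ℝ := fun x ↦ T.inf' hne fun τ ↦ m τ x
  -- On generators of `τ`, `m τ` is `1` while every other `m τ'` is at least `1`; the inequality
  -- extends to `τ` by nonnegative combinations.
  have hφ : ∀ τ ∈ Δ, IsNondegenerate τ → ∀ x ∈ τ, φ x = m τ x := by
    intro τ hτ hτn x hx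
    refine le_antisymm (Finset.inf'_le _ ((hT τ).2 ⟨hτ, hτn⟩)) (Finset.le_inf' _ _ fun τ' hτ' ↦ ?_)
    obtain ⟨hτ', hτ'n⟩ := (hT τ').1 hτ'
    rw [(hfan.isToricCone τ hτ).eq_hull_gen] at hx
    induction hx using Submodule.span_induction with
    | mem x hx =>
      obtain ⟨n, hn, rfl⟩ := hx
      have hnσ := hΔ.isSubdivision.le hτ (gen_subset τ ⟨n, hn, rfl⟩)
      exact (hgen τ hτ hτn n hn).trans_le (hone τ' hτ' hτ'n n hn.1.ne_zero hnσ)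
    | zero => simp
    | add x y _ _ hx hy =>
      rw [map_add, map_add]
      exact add_le_add hx hy
    | smul c x _ hx =>
      have hc : c • x = (c : ℝ) • x := rfl
      rw [hc, map_smul, map_smul]
      exact mul_le_mul_of_nonneg_left hx c.2
  refine ⟨φ, ⟨fun τ hτ ↦ ?_, fun τ hτ u hu ↦ ?_⟩, PointedCone.convex σ, ?_⟩
  · obtain ⟨τ', hτ', hτ'n, hface⟩ := hΔ.exists_isFaceOf_nondegenerate hσ' hτ
    exact ⟨m τ', fun x hx ↦ hφ τ' hτ' hτ'n x (hface.le hx)⟩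
  · obtain ⟨τ', hτ', hτ'n, hface⟩ := hΔ.exists_isFaceOf_nondegenerate hσ' hτ
    have hu' := gen_face_subset hface hu
    rw [hφ τ' hτ' hτ'n _ (gen_subset τ' ⟨u, hu', rfl⟩)]
    exact hgen τ' hτ' hτ'n u hu'
  · intro x _ y _ r s hr hs _
    refine Finset.le_inf' _ _ fun τ hτ ↦ ?_
    rw [map_add, map_smul, map_smul]
    exact add_le_add (mul_le_mul_of_nonneg_left (Finset.inf'_le _ hτ) hr)
      (mul_le_mul_of_nonneg_left (Finset.inf'_le _ hτ) hs)

/-- A bounded face of the lattice hull that contains the generators of a given cone of a moderate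
resolution. -/
lemma IsModerateResolution.exists_isBoundedFace (hΔ : IsModerateResolution Δ σ)
    (hσ : IsToricCone σ) (hσ' : IsNondegenerate σ) {τ : PointedCone ℝ (NR N)} (hτ : τ ∈ Δ) :
    ∃ F, IsBoundedFace (latticeHull σ) F ∧ lat '' gen τ ⊆ F := by
  obtain ⟨τ', hτ', hτ'n, hface⟩ := hΔ.exists_isFaceOf_nondegenerate hσ' hτ
  obtain ⟨b, hb, -, hpos, hone⟩ := hΔ.exists_basis hσ hτ' hτ'n
  refine ⟨_, isBoundedFace_of_dual hσ hpos hone, ?_⟩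
  rintro _ ⟨n, hn, rfl⟩
  refine ⟨subset_convexHull ℝ _
    ⟨n, hn.1.ne_zero, hΔ.isSubdivision.le hτ (gen_subset τ ⟨n, hn, rfl⟩), rfl⟩, ?_⟩
  obtain ⟨i, rfl⟩ := hb ▸ gen_face_subset hface hn
  exact coordSum_basis b i

end ModerateResolution

end ToricFan

theorem theorem3p8 {N : Type*} [AddCommGroup N] [Module.Free ℤ N] [Module.Finite ℤ N]
    (hN : Module.finrank ℤ N = 3)
    (σ : PointedCone ℝ (ToricFan.NR N)) (hσ : ToricFan.IsToricCone σ)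
    (hσ' : ToricFan.IsNondegenerate σ)
    (Δ : Set (PointedCone ℝ (ToricFan.NR N))) (hΔ : ToricFan.IsModerateResolution Δ σ) :
    ToricFan.IsMinimalTerminalQFactorialModel Δ σ ∧ ToricFan.SubdividesCanonicalModel Δ σ := by
  refine ⟨⟨hΔ.isSubdivision, fun τ hτ ↦ hΔ.isSimplicial hσ hσ' hτ,
    fun τ hτ ↦ hΔ.isTerminal hσ hσ' hτ, hΔ.isCanonicalNef hσ hσ'⟩, fun τ hτ ↦ ?_, fun τ hτ u hu ↦ ?_⟩
  · obtain ⟨F, hF, hgen⟩ := hΔ.exists_isBoundedFace hσ hσ' hτ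
    refine ⟨_, ⟨F, hF, rfl⟩, ?_⟩
    rw [(hΔ.isSubdivision.isFan.isToricCone τ hτ).eq_hull_gen]
    exact Submodule.span_mono hgen
  · obtain ⟨F, hF, hgen⟩ := hΔ.exists_isBoundedFace hσ hσ' hτ
    exact ⟨F, hF, hgen ⟨u, hu, rfl⟩⟩
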